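/- Let $G$ be a finite graph with edge set $E$. A local antimagic labeling of $G$ is a bijection $f:E\to\{1,\dots,|E|\}$ such that the weights $w(u)=\sum_{e\ni u}f(e)$ satisfy $w(u)\neq w(v)$ for every edge $uv$; its number of colors is the number of distinct weights, and $\chi_{la}(G)$ is the minimum number of colors over all local antimagic labelings of $G$. A magic rectangle set $MRS(m,n;r)$ is a collection of $r$ arrays of size $m\times n$ in which each of $1,2,\dots,mnr$ appears exactly once, such that all row sums in every array equal $\frac{n(mnr+1)}{2}$ and all column sums in every array equal $\frac{m(mnr+1)}{2}$. Let $rK_{m,n}$ denote the disjoint union of $r$ copies of the complete bipartite graph $K_{m,n}$. **Theorem.** Let $m,n>1$ with $m\neq n$ and let $r\geq 1$. Suppose that either $m,n,r$ are all odd, or $m,n$ are both even with $(m,n)\neq(2,2)$. Then $$\chi_{la}(rK_{m,n})=2.$$ Moreover, in each case a magic rectangle set $MRS(m,n;r)$ exists, and for every $MRS(m,n;r)$, labeling the edge joining the $i$-th vertex of the first part to the $j$-th vertex of the second part in the $t$-th copy of $K_{m,n}$ by the $(i,j)$ entry of the $t$-th rectangle, for all $t,i,j$, gives a local antimagic labeling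 of $rK_{m,n}$ with exactly $2$ colors. -/

import Mathlib

namespace SimpleGraph

/-- The disjoint union `rG` of `r` copies of the graph `G`; the vertex `(t, v)` is the vertex `v`
of the `t`-th copy. -/
def copies {V : Type*} (r : ℕ) (G : SimpleGraph V) : SimpleGraph (Fin r × V) where
  Adj x y := x.1 = y.1 ∧ G.Adj x.2 y.2
  symm := ⟨fun _ _ h => ⟨h.1.symm, h.2.symm⟩⟩
  loopless := ⟨fun _ h => G.irrefl h.2⟩

open Classical in
/-- The weight `w(u)`: the sum of the labels `f e` over all edges `e` of `G` incident with `u`. -/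
noncomputable def vertexWeight {V : Type*} [Fintype V] (G : SimpleGraph V) (f : Sym2 V → ℕ)
    (u : V) : ℕ :=
  ∑ e ∈ G.incidenceFinset u, f e

/-- `f` (of which only the values on the edges of `G` matter) is a local antimagic labeling of `G`:
it maps the edge set bijectively onto `{1, …, |E(G)|}`, and adjacent vertices have distinct
weights. -/
structure IsLocalAntimagic {V : Type*} [Fintype V] (G : SimpleGraph V) (f : Sym2 V → ℕ) :
    Prop where
  bijOn : Set.BijOn f G.edgeSet (Set.Icc 1 G.edgeSet.ncard)
  weight_ne : ∀ u v : V, G.Adj u v → G.vertexWeight f u ≠ G.vertexWeight f v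

/-- The number of colors (distinct vertex weights) in the coloring of `G` induced by `f`. -/
noncomputable def numColors {V : Type*} [Fintype V] (G : SimpleGraph V) (f : Sym2 V → ℕ) : ℕ∞ :=
  (Set.range (G.vertexWeight f)).encard

/-- The local antimagic chromatic number `χ_la(G)`: the minimum number of colors over all local
antimagic labelings of `G` (and `⊤` if there is none). -/
noncomputable def localAntimagicChromaticNumber {V : Type*} [Fintype V] (G : SimpleGraph V) : ℕ∞ :=
  ⨅ (f : Sym2 V → ℕ) (_ : G.IsLocalAntimagic f), G.numColors f

end SimpleGraph

/-- `R` is a magic rectangle set `MRS(a, b; c)`: `c` arrays of size `a × b` in which each of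
`1, …, abc` appears exactly once, all row sums are `b(abc+1)/2` and all column sums are
`a(abc+1)/2`. -/
structure IsMagicRectangleSet (a b c : ℕ) (R : Fin c → Matrix (Fin a) (Fin b) ℕ) : Prop where
  bijOn : Set.BijOn (fun p : Fin c × Fin a × Fin b => R p.1 p.2.1 p.2.2) Set.univ
    (Set.Icc 1 (a * b * c))
  row_sum : ∀ t i, 2 * ∑ j, R t i j = b * (a * b * c + 1)
  col_sum : ∀ t j, 2 * ∑ i, R t i j = a * (a * b * c + 1)

/-! Write N = mnr. Labeling by a magic rectangle set gives doubled weights n(N+1) on one side of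
each copy and m(N+1) on the other. Since m ≠ n, these are two colors and they differ across every
edge; conversely, any edge forces two colors. All the difficulty is in the existence of the
rectangles.

Replacing a label x by 2x - (N+1) turns a magic rectangle set into arrays with distinct entries in a
symmetric set and vanishing row and column sums (`HasZeroSumArrays`). Such arrays can be juxtaposed
freely as long as their values are disjoint.

For even m and n, blocks 2 × 4 suffice when 4 divides a side; otherwise each rectangle also gets one
2 × 6 block (`hasZeroSumArrays_even`).

For odd m and n, one rectangle is built from numbers with two balanced digits x and `kotzigRow h x
c`. A column with c fixed and x running over all digits sums to zero, and suitable groups of four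
such columns have zero rows. A small core (3 × 5, 3 × 7 or 5 × 5) is extended by such groups to the
right and below, and the remaining even corner is tiled (`hasZeroSumArrays_of_core`). A further
balanced digit in base r, permuted differently from cell to cell, turns one rectangle into r of them
(`HasZeroSumArrays.lift_odd`). -/

namespace SimpleGraph

/-! ### Labelings from magic rectangle sets -/

variable {m n r : ℕ}

/-- The edge joining the `i`-th vertex of the first part to the `j`-th vertex of the second part in
the `t`-th copy of `K_{m,n}`. -/
def copiesEdge (p : Fin r × Fin m × Fin n) : Sym2 (Fin r × (Fin m ⊕ Fin n)) :=
  s((p.1, Sum.inl p.2.1), (p.1, Sum.inr p.2.2))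

lemma copiesEdge_injective : Function.Injective (copiesEdge (m := m) (n := n) (r := r)) := by
  rintro ⟨t, i, j⟩ ⟨t', i', j'⟩ h
  simp only [copiesEdge, Sym2.eq_iff, Prod.mk.injEq, Sum.inl.injEq, Sum.inr.injEq, reduceCtorEq,
    and_false, or_false] at h
  simp [h]

lemma edgeSet_copies_completeBipartiteGraph :
    (copies r (completeBipartiteGraph (Fin m) (Fin n))).edgeSet = Set.range copiesEdge := by
  ext e
  induction e with
  | _ x y =>
    obtain ⟨t, v⟩ := x
    obtain ⟨t', v'⟩ := y
    constructor
    · rintro ⟨h, h'⟩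
      simp only at h h'
      subst h
      rcases v with i | j <;> rcases v' with i' | j' <;> simp at h'
      · exact ⟨(t, i, j'), rfl⟩
      · exact ⟨(t, i', j), Sym2.eq_swap⟩
    · rintro ⟨⟨t, i, j⟩, h⟩
      rw [← h]
      exact ⟨rfl, by simp⟩

lemma ncard_edgeSet_copies_completeBipartiteGraph :
    (copies r (completeBipartiteGraph (Fin m) (Fin n))).edgeSet.ncard = m * n * r := by
  rw [edgeSet_copies_completeBipartiteGraph, ← Set.image_univ,
    Set.ncard_image_of_injective _ copiesEdge_injective, Set.ncard_univ]
  simp only [Nat.card_eq_fintype_card, Fintype.card_prod, Fintype.card_fin]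
  ring

lemma vertexWeight_inl (f : Sym2 (Fin r × (Fin m ⊕ Fin n)) → ℕ) (t : Fin r) (i : Fin m) :
    (copies r (completeBipartiteGraph (Fin m) (Fin n))).vertexWeight f (t, Sum.inl i) =
      ∑ j, f (copiesEdge (t, i, j)) := by
  classical
  rw [vertexWeight, ← Finset.sum_image (g := fun j => copiesEdge (t, i, j))
    (by intro j _ j' _ h; simpa using copiesEdge_injective h)]
  refine Finset.sum_congr ?_ fun _ _ => rfl
  ext e
  simp only [mem_incidenceFinset, incidenceSet, edgeSet_copies_completeBipartiteGraph,
    Set.mem_ofPred_eq, Finset.mem_image, Finset.mem_univ, true_and, Set.mem_range]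
  constructor
  · rintro ⟨⟨⟨t', i', j'⟩, rfl⟩, h⟩
    simp only [copiesEdge, Sym2.mem_iff, Prod.mk.injEq, Sum.inl.injEq, reduceCtorEq, and_false,
      or_false] at h
    obtain ⟨rfl, rfl⟩ := h
    exact ⟨j', rfl⟩
  · rintro ⟨j, rfl⟩
    exact ⟨⟨_, rfl⟩, by simp [copiesEdge]⟩

lemma vertexWeight_inr (f : Sym2 (Fin r × (Fin m ⊕ Fin n)) → ℕ) (t : Fin r) (j : Fin n) :
    (copies r (completeBipartiteGraph (Fin m) (Fin n))).vertexWeight f (t, Sum.inr j) =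
      ∑ i, f (copiesEdge (t, i, j)) := by
  classical
  rw [vertexWeight, ← Finset.sum_image (g := fun i => copiesEdge (t, i, j))
    (by intro j _ j' _ h; simpa using copiesEdge_injective h)]
  refine Finset.sum_congr ?_ fun _ _ => rfl
  ext e
  simp only [mem_incidenceFinset, incidenceSet, edgeSet_copies_completeBipartiteGraph,
    Set.mem_ofPred_eq, Finset.mem_image, Finset.mem_univ, true_and, Set.mem_range]
  constructor
  · rintro ⟨⟨⟨t', i', j'⟩, rfl⟩, h⟩
    simp only [copiesEdge, Sym2.mem_iff, Prod.mk.injEq, Sum.inr.injEq, reduceCtorEq, and_false,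
      false_or] at h
    obtain ⟨rfl, rfl⟩ := h
    exact ⟨i', rfl⟩
  · rintro ⟨j, rfl⟩
    exact ⟨⟨_, rfl⟩, by simp [copiesEdge]⟩

/-- A graph with an edge needs at least two colors. -/
lemma IsLocalAntimagic.two_le_numColors {V : Type*} [Fintype V] {G : SimpleGraph V}
    {f : Sym2 V → ℕ} (hf : G.IsLocalAntimagic f) {u v : V} (h : G.Adj u v) :
    2 ≤ G.numColors f := by
  rw [← Set.encard_pair (hf.weight_ne u v h)]
  apply Set.encard_le_encard
  rintro _ (rfl | rfl) <;> exact ⟨_, rfl⟩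

/-- Extension of the entries of `r` matrices to all pairs of vertices of `rK_{m,n}`. -/
def copiesLabelAux (R : Fin r → Matrix (Fin m) (Fin n) ℕ) :
    Fin r × (Fin m ⊕ Fin n) → Fin r × (Fin m ⊕ Fin n) → ℕ
  | (t, Sum.inl i), (_, Sum.inr j) => R t i j
  | _, _ => 0

/-- The labeling of the edges of `rK_{m,n}` by the entries of `r` matrices. -/
def copiesLabel (R : Fin r → Matrix (Fin m) (Fin n) ℕ) : Sym2 (Fin r × (Fin m ⊕ Fin n)) → ℕ :=
  Sym2.lift ⟨fun x y => copiesLabelAux R x y + copiesLabelAux R y x, fun _ _ => add_comm _ _⟩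

lemma copiesLabel_copiesEdge (R : Fin r → Matrix (Fin m) (Fin n) ℕ) (t : Fin r) (i : Fin m)
    (j : Fin n) : copiesLabel R (copiesEdge (t, i, j)) = R t i j := by
  simp [copiesLabel, copiesEdge, copiesLabelAux]

lemma isLocalAntimagic_copiesLabel (hm : 1 < m) (hn : 1 < n) (hr : 1 ≤ r) (hmn : m ≠ n)
    {R : Fin r → Matrix (Fin m) (Fin n) ℕ} (hR : IsMagicRectangleSet m n r R) :
    (copies r (completeBipartiteGraph (Fin m) (Fin n))).IsLocalAntimagic (copiesLabel R) ∧
      (copies r (completeBipartiteGraph (Fin m) (Fin n))).numColors (copiesLabel R) = 2 := by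
  have hl : ∀ t i, 2 * (copies r (completeBipartiteGraph (Fin m) (Fin n))).vertexWeight
      (copiesLabel R) (t, Sum.inl i) = n * (m * n * r + 1) := fun t i => by
    simp only [vertexWeight_inl, copiesLabel_copiesEdge, hR.row_sum]
  have hr' : ∀ t j, 2 * (copies r (completeBipartiteGraph (Fin m) (Fin n))).vertexWeight
      (copiesLabel R) (t, Sum.inr j) = m * (m * n * r + 1) := fun t j => by
    simp only [vertexWeight_inr, copiesLabel_copiesEdge, hR.col_sum]
  have hne : n * (m * n * r + 1) ≠ m * (m * n * r + 1) := fun h =>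
    hmn (Nat.eq_of_mul_eq_mul_right (Nat.succ_pos _) h).symm
  have hf : (copies r (completeBipartiteGraph (Fin m) (Fin n))).IsLocalAntimagic
      (copiesLabel R) := by
    constructor
    · rw [ncard_edgeSet_copies_completeBipartiteGraph, edgeSet_copies_completeBipartiteGraph,
        ← Set.image_univ, ← Set.bijOn_comp_iff copiesEdge_injective.injOn]
      exact hR.bijOn.congr fun p _ => (copiesLabel_copiesEdge R p.1 p.2.1 p.2.2).symm
    · rintro ⟨t, v⟩ ⟨t', v'⟩ ⟨-, h⟩ hw
      rcases v with i | j <;> rcases v' with i' | j' <;> simp at h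
      · exact hne (by rw [← hl t i, ← hr' t' j', hw])
      · exact hne (by rw [← hl t' i', ← hr' t j, hw])
  refine ⟨hf, le_antisymm ?_ ?_⟩
  · let t : Fin r := ⟨0, hr⟩
    let i : Fin m := ⟨0, by omega⟩
    let j : Fin n := ⟨0, by omega⟩
    -- One vertex from each side represents the two colors.
    rw [← Set.encard_pair (hf.weight_ne (t, Sum.inl i) (t, Sum.inr j) ⟨rfl, by simp⟩)]
    refine Set.encard_le_encard ?_
    rintro _ ⟨⟨t', i' | j'⟩, rfl⟩
    · have := hl t i
      rw [← hl t' i'] at this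
      left
      omega
    · have := hr' t j
      rw [← hr' t' j'] at this
      right
      simp only [Set.mem_singleton_iff]
      omega
  · exact hf.two_le_numColors (u := (⟨0, hr⟩, Sum.inl ⟨0, by omega⟩))
      (v := (⟨0, hr⟩, Sum.inr ⟨0, by omega⟩)) ⟨rfl, by simp⟩

end SimpleGraph

/-! ### Zero-sum arrays and their gluing -/

/-- There is a family, indexed by `ι`, of integer arrays of shape `α × β` with vanishing row and
column sums whose entries are pairwise distinct elements of `S`. -/
def HasZeroSumArrays (ι α β : Type) [Fintype α] [Fintype β] (S : Set ℤ) : Prop :=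
  ∃ A : ι → α → β → ℤ, (∀ t i, ∑ j, A t i j = 0) ∧ (∀ t j, ∑ i, A t i j = 0) ∧
    (∀ t i j, A t i j ∈ S) ∧
    ∀ t i j t' i' j', A t i j = A t' i' j' → t = t' ∧ i = i' ∧ j = j'

namespace HasZeroSumArrays

variable {ι ι' κ l α α' β β' : Type} [Fintype κ] [Fintype l]
  [Fintype α] [Fintype α'] [Fintype β] [Fintype β'] {S S' : Set ℤ}

lemma mono (h : HasZeroSumArrays ι α β S) (hS : S ⊆ S') : HasZeroSumArrays ι α β S' := by
  obtain ⟨A, h1, h2, h3, h4⟩ := h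
  exact ⟨A, h1, h2, fun t i j => hS (h3 t i j), h4⟩

lemma transpose (h : HasZeroSumArrays ι α β S) : HasZeroSumArrays ι β α S := by
  obtain ⟨A, h1, h2, h3, h4⟩ := h
  exact ⟨fun t i j => A t j i, h2, h1, fun t i j => h3 t j i, fun t i j t' i' j' h =>
    ⟨(h4 _ _ _ _ _ _ h).1, (h4 _ _ _ _ _ _ h).2.2, (h4 _ _ _ _ _ _ h).2.1⟩⟩

lemma reindex [Fintype ι] [Fintype ι'] (h : HasZeroSumArrays ι α β S) (hι : Fintype.card ι' = Fintype.card ι)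
    (hα : Fintype.card α' = Fintype.card α) (hβ : Fintype.card β' = Fintype.card β) :
    HasZeroSumArrays ι' α' β' S := by
  obtain ⟨A, h1, h2, h3, h4⟩ := h
  let e := Fintype.equivOfCardEq hι
  let a := Fintype.equivOfCardEq hα
  let b := Fintype.equivOfCardEq hβ
  refine ⟨fun t i j => A (e t) (a i) (b j), fun t i => ?_, fun t j => ?_,
    fun t i j => h3 _ _ _, fun t i j t' i' j' h => ?_⟩
  · rw [b.sum_comp (fun j => A (e t) (a i) j), h1]
  · rw [a.sum_comp (fun i => A (e t) i (b j)), h2]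
  · simpa using h4 _ _ _ _ _ _ h

lemma hcat (h : HasZeroSumArrays ι α β S) (h' : HasZeroSumArrays ι α β' S')
    (hS : Disjoint S S') : HasZeroSumArrays ι α (β ⊕ β') (S ∪ S') := by
  obtain ⟨A, h1, h2, h3, h4⟩ := h
  obtain ⟨B, g1, g2, g3, g4⟩ := h'
  refine ⟨fun t i j => Sum.elim (A t i) (B t i) j, fun t i => ?_, ?_, ?_, ?_⟩
  · simp [h1, g1]
  · rintro t (j | j)
    · simpa using h2 t j
    · simpa using g2 t j
  · rintro t i (j | j)
    · exact Or.inl (h3 t i j)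
    · exact Or.inr (g3 t i j)
  · rintro t i (j | j) t' i' (j' | j') h
    · simpa using h4 _ _ _ _ _ _ h
    · simp only [Sum.elim_inl, Sum.elim_inr] at h
      exact (Set.disjoint_left.1 hS (h3 t i j) (h ▸ g3 t' i' j')).elim
    · simp only [Sum.elim_inl, Sum.elim_inr] at h
      exact (Set.disjoint_left.1 hS (h3 t' i' j') (h ▸ g3 t i j)).elim
    · simpa using g4 _ _ _ _ _ _ h

lemma vcat (h : HasZeroSumArrays ι α β S) (h' : HasZeroSumArrays ι α' β S')
    (hS : Disjoint S S') : HasZeroSumArrays ι (α ⊕ α') β (S ∪ S') :=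
  (h.transpose.hcat h'.transpose hS).transpose

lemma union (h : HasZeroSumArrays ι α β S) (h' : HasZeroSumArrays ι' α β S')
    (hS : Disjoint S S') : HasZeroSumArrays (ι ⊕ ι') α β (S ∪ S') := by
  obtain ⟨A, h1, h2, h3, h4⟩ := h
  obtain ⟨B, g1, g2, g3, g4⟩ := h'
  refine ⟨Sum.elim A B, ?_, ?_, ?_, ?_⟩
  · rintro (t | t)
    exacts [h1 t, g1 t]
  · rintro (t | t)
    exacts [h2 t, g2 t]
  · rintro (t | t) i j
    exacts [Or.inl (h3 t i j), Or.inr (g3 t i j)]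
  · rintro (t | t) i j (t' | t') i' j' h
    · simpa using h4 _ _ _ _ _ _ h
    · simp only [Sum.elim_inl, Sum.elim_inr] at h
      exact (Set.disjoint_left.1 hS (h3 t i j) (h ▸ g3 t' i' j')).elim
    · simp only [Sum.elim_inl, Sum.elim_inr] at h
      exact (Set.disjoint_left.1 hS (h3 t' i' j') (h ▸ g3 t i j)).elim
    · simpa using g4 _ _ _ _ _ _ h

/-- Each block has zero row and column sums on its own, so blocks may be placed in a grid in any
order. -/
lemma tile (h : HasZeroSumArrays (ι × κ × l) α β S) :
    HasZeroSumArrays ι (κ × α) (l × β) S := by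
  obtain ⟨A, h1, h2, h3, h4⟩ := h
  refine ⟨fun t i j => A (t, i.1, j.1) i.2 j.2, fun t i => ?_, fun t j => ?_,
    fun t i j => h3 _ _ _, ?_⟩
  · simp [Fintype.sum_prod_type, h1]
  · simp [Fintype.sum_prod_type, h2]
  · rintro t ⟨i, i₂⟩ ⟨j, j₂⟩ t' ⟨i', i₂'⟩ ⟨j', j₂'⟩ h
    have := h4 _ _ _ _ _ _ h
    simp only [Prod.mk.injEq] at this ⊢
    tauto

/-- Two-row arrays whose columns are of the form `(x, -x)`. -/
lemma of_signed (a : ι → β → ℤ) (ha : ∀ t, ∑ j, a t j = 0) (h0 : ∀ t j, a t j ≠ 0)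
    (hinj : ∀ t j t' j', |a t j| = |a t' j'| → t = t' ∧ j = j')
    (hS : ∀ t j, a t j ∈ S ∧ -a t j ∈ S) : HasZeroSumArrays ι (Fin 2) β S := by
  refine ⟨fun t i j => if i = 0 then a t j else -a t j, fun t i => ?_, fun t j => ?_,
    fun t i j => ?_, fun t i j t' i' j' h => ?_⟩
  · dsimp only
    split_ifs
    · exact ha t
    · rw [Finset.sum_neg_distrib, ha, neg_zero]
  · simp
  · dsimp only
    split_ifs
    exacts [(hS t j).1, (hS t j).2]
  · have habs : |a t j| = |a t' j'| := by
      have := congrArg abs h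
      simp only [apply_ite abs, abs_neg, ite_self] at this
      exact this
    obtain ⟨rfl, rfl⟩ := hinj _ _ _ _ habs
    have := h0 t j
    refine ⟨rfl, ?_, rfl⟩
    dsimp only at h
    split_ifs at h <;> omega

end HasZeroSumArrays

/-! ### Even dimensions -/

/-- The integers whose absolute value is `d * u + e` for some `L ≤ u < U`. -/
def signedProgression (d e L U : ℕ) : Set ℤ :=
  {v | ∃ u : ℕ, L ≤ u ∧ u < U ∧ |v| = d * u + e}

section

variable {d e L U W : ℕ}

lemma signedProgression_mono {L' U' : ℕ} (hL : L' ≤ L) (hU : U ≤ U') :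
    signedProgression d e L U ⊆ signedProgression d e L' U' := by
  rintro v ⟨u, h1, h2, h3⟩
  exact ⟨u, by omega, by omega, h3⟩

lemma signedProgression_union_subset (hL : L ≤ U) (hU : U ≤ W) :
    signedProgression d e L U ∪ signedProgression d e U W ⊆ signedProgression d e L W :=
  Set.union_subset (signedProgression_mono le_rfl hU) (signedProgression_mono hL le_rfl)

lemma disjoint_signedProgression (hd : 0 < d) :
    Disjoint (signedProgression d e L U) (signedProgression d e U W) := by
  rw [Set.disjoint_left]
  rintro v ⟨u, h1, h2, h3⟩ ⟨u', h1', h2', h3'⟩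
  have h : d * u = d * u' := by zify; linarith
  have := Nat.eq_of_mul_eq_mul_left hd h
  omega

/-- Two-row arrays from sign patterns on a progression. -/
lemma hasZeroSumArrays_signedProgression {ι β : Type} [Fintype β] (hd : 0 < d)
    (hL : 0 < d * L + e) (w : ι → β → ℕ) (s : ι → β → ℤ) (hs : ∀ t j, |s t j| = 1)
    (hw : ∀ t j t' j', w t j = w t' j' → t = t' ∧ j = j') (hwL : ∀ t j, L ≤ w t j)
    (hwU : ∀ t j, w t j < U) (hsum : ∀ t, ∑ j, s t j * (d * w t j + e) = 0) :
    HasZeroSumArrays ι (Fin 2) β (signedProgression d e L U) := by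
  have habs : ∀ t j, |s t j * (d * w t j + e)| = d * w t j + e := fun t j => by
    rw [abs_mul, hs, one_mul, abs_of_nonneg (by positivity)]
  refine .of_signed (fun t j => s t j * (d * w t j + e)) hsum (fun t j h => ?_)
    (fun t j t' j' h => ?_) (fun t j => ⟨⟨w t j, hwL t j, hwU t j, habs t j⟩,
      ⟨w t j, hwL t j, hwU t j, by rw [abs_neg, habs]⟩⟩)
  · have h1 := habs t j
    rw [h, abs_zero] at h1
    have h2 : d * L ≤ d * w t j := Nat.mul_le_mul_left _ (hwL t j)
    zify at h2 hL
    linarith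
  · rw [habs, habs] at h
    apply hw
    have h' : d * w t j = d * w t' j' := by zify; linarith
    exact Nat.eq_of_mul_eq_mul_left hd h'

/-- Four consecutive terms of a progression cancel with signs +, -, -, +. -/
lemma hasZeroSumArrays_two_four (hd : 0 < d) (hL : 0 < d * L + e) (k : ℕ) :
    HasZeroSumArrays (Fin k) (Fin 2) (Fin 4) (signedProgression d e L (L + 4 * k)) := by
  refine hasZeroSumArrays_signedProgression hd hL (fun t j => L + 4 * t + j)
    (fun _ j => ![1, -1, -1, 1] j) (fun t j => ?_) (fun t j t' j' h => ?_)
    (fun t j => by omega) (fun t j => by omega) (fun t => ?_)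
  · fin_cases j <;> simp
  · exact ⟨Fin.ext (by omega), Fin.ext (by omega)⟩
  · simp [Fin.sum_univ_four]
    ring

lemma hasZeroSumArrays_two_six_pair (hd : 0 < d) (hL : 0 < d * L + e) :
    HasZeroSumArrays (Fin 2) (Fin 2) (Fin 6) (signedProgression d e L (L + 12)) := by
  have hinj : ∀ t j t' j', (![![0, 2, 7, 1, 3, 5], ![4, 9, 11, 6, 8, 10]] : Fin 2 → Fin 6 → ℕ) t j =
      (![![0, 2, 7, 1, 3, 5], ![4, 9, 11, 6, 8, 10]] : Fin 2 → Fin 6 → ℕ) t' j' →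
      t = t' ∧ j = j' := by decide
  have hlt : ∀ t j, (![![0, 2, 7, 1, 3, 5], ![4, 9, 11, 6, 8, 10]] : Fin 2 → Fin 6 → ℕ) t j < 12 :=
    by decide
  refine hasZeroSumArrays_signedProgression hd hL
    (fun t j => L + (![![0, 2, 7, 1, 3, 5], ![4, 9, 11, 6, 8, 10]] : Fin 2 → Fin 6 → ℕ) t j)
    (fun _ j => ![1, 1, 1, -1, -1, -1] j) (fun t j => ?_)
    (fun t j t' j' h => hinj _ _ _ _ (Nat.add_left_cancel h))
    (fun t j => Nat.le_add_right _ _) (fun t j => Nat.add_lt_add_left (hlt t j) _) (fun t => ?_)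
  · fin_cases j <;> simp
  · fin_cases t <;> simp [Fin.sum_univ_six] <;> ring

/-- Here -1 - 3 - 5 + 7 - 9 + 11 = 0. The signs are unbalanced, so the cancellation depends on
starting at 1; this block handles odd r. -/
lemma hasZeroSumArrays_two_six_one :
    HasZeroSumArrays (Fin 1) (Fin 2) (Fin 6) (signedProgression 2 1 0 6) := by
  refine hasZeroSumArrays_signedProgression (by norm_num) (by norm_num) (fun _ j => j)
    (fun _ j => ![-1, -1, -1, 1, -1, 1] j) (fun t j => ?_)
    (fun t j t' j' h => ⟨Subsingleton.elim _ _, Fin.ext h⟩)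
    (fun t j => Nat.zero_le _) (fun t j => j.2) (fun t => ?_)
  · fin_cases j <;> simp
  · simp [Fin.sum_univ_six]

lemma hasZeroSumArrays_two_six (r : ℕ) :
    HasZeroSumArrays (Fin r) (Fin 2) (Fin 6) (signedProgression 2 1 0 (6 * r)) := by
  induction r using Nat.twoStepInduction with
  | zero => exact ⟨fun t => t.elim0, fun t => t.elim0, fun t => t.elim0, fun t => t.elim0,
      fun t => t.elim0⟩
  | one => exact hasZeroSumArrays_two_six_one
  | more r ih _ =>
    have h := ih.union (hasZeroSumArrays_two_six_pair (d := 2) (e := 1) (L := 6 * r)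
      (by norm_num) (by omega)) (disjoint_signedProgression (by norm_num))
    exact (h.mono (signedProgression_union_subset (by omega) (by omega))).reindex
      (by simp) rfl rfl

/-- Rectangles tiled by `2 × 4` blocks. -/
lemma hasZeroSumArrays_tile_two_four (hd : 0 < d) (hL : 0 < d * L + e) (r p q : ℕ) :
    HasZeroSumArrays (Fin r) (Fin (2 * p)) (Fin (4 * q))
      (signedProgression d e L (L + 4 * (r * p * q))) := by
  have h := (hasZeroSumArrays_two_four hd hL (r * p * q)).reindex
    (ι' := Fin r × Fin p × Fin q) (α' := Fin 2) (β' := Fin 4)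
    (by simp [mul_assoc]) rfl rfl
  exact h.tile.reindex rfl (by simp [mul_comm]) (by simp [mul_comm])

end

/-- Zero-sum arrays of even dimensions, one of them at least `4`, using each odd integer of absolute
value less than `mnr`. -/
lemma hasZeroSumArrays_even {m n r : ℕ} (hm : Even m) (hn : Even n) (hm0 : 1 < m) (hn0 : 1 < n)
    (h : (m, n) ≠ (2, 2)) :
    HasZeroSumArrays (Fin r) (Fin m) (Fin n) (signedProgression 2 1 0 (m * n * r / 2)) := by
  have key : ∀ {m n : ℕ}, Even m → Even n → 1 < m → 2 < n →
      HasZeroSumArrays (Fin r) (Fin m) (Fin n) (signedProgression 2 1 0 (m * n * r / 2)) := by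
    intro m n hm hn hm0 hn0
    obtain ⟨a, rfl⟩ := hm
    obtain ⟨b, rfl⟩ := hn
    have hU : (a + a) * (b + b) * r / 2 = 2 * (r * a * b) := by
      rw [show (a + a) * (b + b) * r = 2 * (2 * (r * a * b)) by ring]
      omega
    rw [hU]
    rcases Nat.even_or_odd b with ⟨q, rfl⟩ | ⟨q, rfl⟩
    · have := hasZeroSumArrays_tile_two_four (d := 2) (e := 1) (L := 0) (by norm_num)
        (by norm_num) r a q
      refine (this.mono (signedProgression_mono le_rfl (le_of_eq (by ring)))).reindex rfl ?_ ?_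
      · simp; ring
      · simp; ring
    rcases Nat.even_or_odd a with ⟨p, rfl⟩ | ⟨p, rfl⟩
    · have := (hasZeroSumArrays_tile_two_four (d := 2) (e := 1) (L := 0) (by norm_num)
        (by norm_num) r (2 * q + 1) p).transpose
      refine (this.mono (signedProgression_mono le_rfl (le_of_eq (by ring)))).reindex rfl ?_ ?_
      · simp; ring
      · simp; ring
    -- The bound n > 2 excludes q = 0, so n = 4c + 6 has room for a 2 × 6 block. The top two rows
    -- are that block followed by 2 × 4 blocks; the other 4p rows are tiled by 4 × 2 blocks.
    obtain ⟨q, rfl⟩ : ∃ c, q = c + 1 := ⟨q - 1, by omega⟩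
    have h1 := (hasZeroSumArrays_two_six r).hcat
      (hasZeroSumArrays_tile_two_four (d := 2) (e := 1) (L := 6 * r) (by norm_num)
        (by omega) r 1 q) (disjoint_signedProgression (by norm_num))
    have h2 := (h1.mono (signedProgression_union_subset (by omega) (by omega))).vcat
      (((hasZeroSumArrays_tile_two_four (d := 2) (e := 1) (L := 6 * r + 4 * (r * 1 * q))
        (by norm_num) (by omega) r (3 + 2 * q) p).transpose).reindex rfl rfl
          (β' := Fin 6 ⊕ Fin (4 * q)) (by simp; ring))
      (disjoint_signedProgression (by norm_num))
    refine (h2.mono ((signedProgression_union_subset (by omega) (by omega)).trans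
      (signedProgression_mono le_rfl (le_of_eq (by ring))))).reindex rfl ?_ ?_
    · simp; ring
    · simp; ring
  by_cases h2 : 2 < n
  · exact key hm hn hm0 h2
  · have hn2 : n = 2 := by omega
    have hm2 : m ≠ 2 := fun h' => h (by rw [h', hn2])
    rw [mul_comm m n]
    exact (key hn hm hn0 (by omega)).transpose

/-! ### Odd dimensions, a single rectangle -/

/-- For fixed `x`, a permutation of the integers `c` with `|c| ≤ h`. The permutations for `x = -1`,
`0` and `1` add up to zero, and the others come in pairs of opposites. -/
def kotzigRow (h x c : ℤ) : ℤ :=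
  if x = 0 then c
  else if x = 1 then (if c ≤ 0 then -2 * c - h else h + 1 - 2 * c)
  else if x = -1 then (if c ≤ 0 then c + h else c - h - 1)
  else if 0 < x then -c else c

/-- The number with digits `x` and `kotzigRow h x c` in base `2 * h + 1`. -/
def kotzigEntry (h x c : ℤ) : ℤ := (2 * h + 1) * x + kotzigRow h x c

section

variable {h x x' c c' : ℤ}

lemma abs_kotzigRow_le (hc : |c| ≤ h) : |kotzigRow h x c| ≤ h := by
  rw [abs_le] at hc ⊢
  unfold kotzigRow
  split_ifs <;> omega

lemma kotzigRow_injOn (hc : |c| ≤ h) (hc' : |c'| ≤ h) (heq : kotzigRow h x c = kotzigRow h x c') :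
    c = c' := by
  rw [abs_le] at hc hc'
  unfold kotzigRow at heq
  split_ifs at heq <;> omega

/-- Digits of absolute value at most h in base 2h + 1 are unique. -/
lemma kotzigEntry_inj (hc : |c| ≤ h) (hc' : |c'| ≤ h)
    (heq : kotzigEntry h x c = kotzigEntry h x' c') : x = x' ∧ c = c' := by
  have h1 := abs_le.1 (abs_kotzigRow_le (x := x) hc)
  have h2 := abs_le.1 (abs_kotzigRow_le (x := x') hc')
  unfold kotzigEntry at heq
  have hx : x = x' := by
    rcases lt_trichotomy x x' with hlt | rfl | hlt
    · nlinarith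
    · rfl
    · nlinarith
  subst hx
  exact ⟨rfl, kotzigRow_injOn hc hc' (by linarith)⟩

lemma abs_kotzigEntry_le {k : ℤ} (hx : |x| ≤ k) (hc : |c| ≤ h) :
    |kotzigEntry h x c| ≤ (2 * h + 1) * k + h := by
  have h0 : 0 ≤ h := (abs_nonneg c).trans hc
  refine (abs_add_le _ _).trans (add_le_add ?_ (abs_kotzigRow_le hc))
  rw [abs_mul, abs_of_nonneg (by positivity)]
  gcongr

/-- For c > 0 the sum `kotzigRow h x c + kotzigRow h x (-c)` does not depend on c: it is 1, -1 or 0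
according as x is 1, -1 or anything else. It is thus odd in x. -/
lemma kotzigEntry_add_four {c d : ℤ} (hc : 0 < c) (hd : 0 < d) :
    kotzigEntry h x c + kotzigEntry h x (-c) + kotzigEntry h (-x) d +
      kotzigEntry h (-x) (-d) = 0 := by
  unfold kotzigEntry
  rw [mul_neg]
  generalize (2 * h + 1) * x = y
  unfold kotzigRow
  split_ifs <;> omega

end

/-- The entries with `|x| ≤ k` and `L ≤ |c| < U`. -/
def kotzigSet (h k L U : ℤ) : Set ℤ :=
  {v | ∃ x c : ℤ, |x| ≤ k ∧ L ≤ |c| ∧ |c| < U ∧ v = kotzigEntry h x c}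

section

variable {h k L U W : ℤ}

lemma disjoint_kotzigSet (hW : W ≤ h + 1) :
    Disjoint (kotzigSet h k L U) (kotzigSet h k U W) := by
  rw [Set.disjoint_left]
  rintro v ⟨x, c, h1, h2, h3, h4⟩ ⟨x', c', h1', h2', h3', h4'⟩
  obtain ⟨-, rfl⟩ := kotzigEntry_inj (by omega) (by omega) (h4.symm.trans h4')
  omega

lemma kotzigSet_union_subset (hL : L ≤ U) (hU : U ≤ W) :
    kotzigSet h k L U ∪ kotzigSet h k U W ⊆ kotzigSet h k L W := by
  rintro v (⟨x, c, h1, h2, h3, h4⟩ | ⟨x, c, h1, h2, h3, h4⟩)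
  · exact ⟨x, c, h1, h2, by omega, h4⟩
  · exact ⟨x, c, h1, by omega, h3, h4⟩

lemma disjoint_kotzigSet_signedProgression {B P : ℕ} (hU : U ≤ h + 1)
    (hB : (2 * h + 1) * k + h < B) : Disjoint (kotzigSet h k L U) (signedProgression 1 0 B P) := by
  rw [Set.disjoint_left]
  rintro v ⟨x, c, h1, h2, h3, rfl⟩ ⟨u, h1', h2', h3'⟩
  have := abs_kotzigEntry_le h1 (show |c| ≤ h by omega)
  push_cast at h3'
  omega

/-- Zero-sum arrays with `4` columns and `2 * k + 1` rows. -/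
lemma hasZeroSumArrays_kotzig_four {k : ℕ} (hk : ∀ c, ∑ i : Fin (2 * k + 1),
      kotzigEntry h ((i : ℤ) - k) c = 0) (hk' : ∀ c, ∑ i : Fin (2 * k + 1),
      kotzigEntry h (-((i : ℤ) - k)) c = 0) {L : ℤ} (hL : 1 ≤ L) (p : ℕ)
    (hp : L + 2 * p ≤ h + 1) :
    HasZeroSumArrays (Fin p) (Fin (2 * k + 1)) (Fin 4) (kotzigSet h k L (L + 2 * p)) := by
  let C : Fin p → Fin 4 → ℤ := fun t =>
    ![L + 2 * t, -(L + 2 * t), L + 2 * t + 1, -(L + 2 * t + 1)]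
  -- The digit x changes sign between the pairs ±c and ±(c + 1), as `kotzigEntry_add_four` requires;
  -- each column still contains every x once.
  let X : Fin (2 * k + 1) → Fin 4 → ℤ := fun i =>
    ![(i : ℤ) - k, (i : ℤ) - k, -((i : ℤ) - k), -((i : ℤ) - k)]
  have hC : ∀ t j, L ≤ |C t j| ∧ |C t j| < L + 2 * p := by
    intro t j
    have := t.2
    fin_cases j <;> simp only [C, Fin.zero_eta, Fin.mk_one, Fin.reduceFinMk, Matrix.cons_val] <;>
      constructor <;> (try rw [abs_neg]) <;> rw [abs_of_nonneg (by omega)] <;> omega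
  have hCinj : ∀ t j t' j', C t j = C t' j' → t = t' ∧ j = j' := by
    intro t j t' j' hC
    rw [Fin.ext_iff]
    fin_cases j <;> fin_cases j' <;>
      simp only [C, Fin.zero_eta, Fin.mk_one, Fin.reduceFinMk, Matrix.cons_val] at hC <;>
      simp <;> omega
  have hX : ∀ i j, |X i j| ≤ k := by
    intro i j
    have := i.2
    fin_cases j <;> simp only [X, Fin.zero_eta, Fin.mk_one, Fin.reduceFinMk, Matrix.cons_val] <;>
      rw [abs_le] <;> omega
  have hXinj : ∀ i j i', X i j = X i' j → i = i' := by
    intro i j i' h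
    rw [Fin.ext_iff]
    fin_cases j <;>
      simp only [X, Fin.zero_eta, Fin.mk_one, Fin.reduceFinMk, Matrix.cons_val] at h <;> omega
  refine ⟨fun t i j => kotzigEntry h (X i j) (C t j), fun t i => ?_, fun t j => ?_,
    fun t i j => ⟨_, _, hX i j, (hC t j).1, (hC t j).2, rfl⟩, fun t i j t' i' j' heq => ?_⟩
  · rw [Fin.sum_univ_four]
    exact kotzigEntry_add_four (show 0 < L + 2 * (t : ℤ) by omega)
      (show 0 < L + 2 * (t : ℤ) + 1 by omega)
  · fin_cases j
    exacts [hk _, hk _, hk' _, hk' _]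
  · obtain ⟨hx, hc⟩ := kotzigEntry_inj (by have := hC t j; omega) (by have := hC t' j'; omega) heq
    obtain ⟨rfl, rfl⟩ := hCinj _ _ _ _ hc
    exact ⟨rfl, hXinj _ _ _ hx, rfl⟩

/-- A single zero-sum array from a matrix `X` of first digits, with `c` depending only on the
column. -/
lemma hasZeroSumArrays_kotzig_core {k l : ℕ} (X : Fin (2 * k + 1) → Fin (2 * l + 1) → ℤ)
    (hl : (l : ℤ) ≤ h) (hX : ∀ i j, |X i j| ≤ k) (hXinj : ∀ i j i', X i j = X i' j → i = i')
    (hrow : ∀ i, ∑ j : Fin (2 * l + 1), kotzigEntry h (X i j) ((j : ℤ) - l) = 0)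
    (hcol : ∀ j : Fin (2 * l + 1), ∑ i, kotzigEntry h (X i j) ((j : ℤ) - l) = 0) :
    HasZeroSumArrays (Fin 1) (Fin (2 * k + 1)) (Fin (2 * l + 1)) (kotzigSet h k 0 (l + 1)) := by
  have hC : ∀ j : Fin (2 * l + 1), |(j : ℤ) - l| ≤ l := fun j => by
    rw [abs_le]
    omega
  refine ⟨fun _ i j => kotzigEntry h (X i j) ((j : ℤ) - l), fun _ => hrow, fun _ => hcol,
    fun t i j => ⟨_, _, hX i j, abs_nonneg _, by have := hC j; omega, rfl⟩,
    fun t i j t' i' j' heq => ?_⟩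
  obtain ⟨hx, hc⟩ := kotzigEntry_inj ((hC j).trans hl) ((hC j').trans hl) heq
  obtain rfl : j = j' := Fin.ext (by omega)
  exact ⟨Subsingleton.elim _ _, hXinj _ _ _ hx, rfl⟩

/-- In this core and the next two, every column of the matrix is a permutation of the digits x, and
the row sums vanish identically in h. The latter matters because h grows with the final rectangle.
-/
lemma hasZeroSumArrays_core_three_five (hh : 2 ≤ h) :
    HasZeroSumArrays (Fin 1) (Fin 3) (Fin 5) (kotzigSet h 1 0 3) := by
  refine hasZeroSumArrays_kotzig_core (k := 1) (l := 2)
    ![![-1, 1, 0, 1, -1], ![0, -1, 1, 0, 0], ![1, 0, -1, -1, 1]] hh (by decide) (by decide) ?_ ?_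
  · intro i
    fin_cases i <;> simp [Fin.sum_univ_succ, kotzigEntry, kotzigRow] <;> ring
  · intro j
    fin_cases j <;> simp [Fin.sum_univ_succ, kotzigEntry, kotzigRow] <;> ring

lemma hasZeroSumArrays_core_three_seven (hh : 3 ≤ h) :
    HasZeroSumArrays (Fin 1) (Fin 3) (Fin 7) (kotzigSet h 1 0 4) := by
  refine hasZeroSumArrays_kotzig_core (k := 1) (l := 3)
    ![![-1, 1, 0, 0, -1, 1, 0], ![0, 0, 1, -1, 1, 0, -1], ![1, -1, -1, 1, 0, -1, 1]] hh
    (by decide) (by decide) ?_ ?_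
  · intro i
    fin_cases i <;> simp [Fin.sum_univ_succ, kotzigEntry, kotzigRow] <;> ring
  · intro j
    fin_cases j <;> simp [Fin.sum_univ_succ, kotzigEntry, kotzigRow] <;> ring

lemma hasZeroSumArrays_core_five_five (hh : 2 ≤ h) :
    HasZeroSumArrays (Fin 1) (Fin 5) (Fin 5) (kotzigSet h 2 0 3) := by
  refine hasZeroSumArrays_kotzig_core (k := 2) (l := 2)
    ![![-2, 2, 1, 1, -2], ![-1, 1, -1, 2, -1], ![0, 0, 2, -2, 0], ![1, -1, 0, -1, 1],
      ![2, -2, -2, 0, 2]] hh (by decide) (by decide) ?_ ?_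
  · intro i
    fin_cases i <;> simp [Fin.sum_univ_succ, kotzigEntry, kotzigRow] <;> ring
  · intro j
    fin_cases j <;> simp [Fin.sum_univ_succ, kotzigEntry, kotzigRow] <;> ring

lemma sum_kotzigEntry_one (h c : ℤ) :
    (∑ i : Fin 3, kotzigEntry h ((i : ℤ) - (1 : ℕ)) c = 0) ∧
      ∑ i : Fin 3, kotzigEntry h (-((i : ℤ) - (1 : ℕ))) c = 0 := by
  constructor <;> simp [Fin.sum_univ_succ, kotzigEntry, kotzigRow] <;> split_ifs <;> ring

lemma sum_kotzigEntry_two (h c : ℤ) :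
    (∑ i : Fin 5, kotzigEntry h ((i : ℤ) - (2 : ℕ)) c = 0) ∧
      ∑ i : Fin 5, kotzigEntry h (-((i : ℤ) - (2 : ℕ))) c = 0 := by
  constructor <;> simp [Fin.sum_univ_succ, kotzigEntry, kotzigRow] <;> split_ifs <;> ring

/-- Assembly of an odd rectangle: a core with `2 * k + 1` rows and `2 * l + 1` columns is extended
to the right and downwards by groups of four, and the remaining even block is tiled. -/
lemma hasZeroSumArrays_of_core {k l : ℕ} (p q : ℕ) (hkl : k ≤ l + 2 * p)
    (hcore : HasZeroSumArrays (Fin 1) (Fin (2 * k + 1)) (Fin (2 * l + 1))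
      (kotzigSet (l + 2 * (p + q) : ℕ) k 0 (l + 1)))
    (hk : ∀ h c, (∑ i : Fin (2 * k + 1), kotzigEntry h ((i : ℤ) - k) c = 0) ∧
      ∑ i : Fin (2 * k + 1), kotzigEntry h (-((i : ℤ) - k)) c = 0) :
    HasZeroSumArrays (Fin 1) (Fin (2 * k + 1 + 4 * q)) (Fin (2 * l + 1 + 4 * p))
      {v | 2 * |v| + 1 ≤ ((2 * k + 1 + 4 * q) * (2 * l + 1 + 4 * p) : ℕ)} := by
  -- The full width is 2k + 1 + 2w, so w counts the pairs of columns of the even corner.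
  obtain ⟨w, hw⟩ := Nat.exists_eq_add_of_le hkl
  -- The values |c| ≤ h are shared out: |c| ≤ l to the core, the next 2p to the right extension, the
  -- last 2q to the one below.
  set h : ℕ := l + 2 * (p + q) with hh
  have right : HasZeroSumArrays (Fin 1) (Fin (2 * k + 1)) (Fin (4 * p))
      (kotzigSet h k (l + 1) (l + 1 + 2 * p)) :=
    ((hasZeroSumArrays_kotzig_four (fun c => (hk h c).1) (fun c => (hk h c).2) (by omega) p
      (by push_cast [hh]; omega)).reindex (ι' := Fin 1 × Fin 1 × Fin p) (by simp) rfl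
        rfl).tile.reindex rfl (by simp) (by simp [mul_comm])
  have below : HasZeroSumArrays (Fin 1) (Fin (4 * q)) (Fin (2 * k + 1))
      (kotzigSet h k (l + 1 + 2 * p) (l + 1 + 2 * p + 2 * q)) :=
    ((hasZeroSumArrays_kotzig_four (fun c => (hk h c).1) (fun c => (hk h c).2) (by omega) q
      (by push_cast [hh]; omega)).transpose.reindex (ι' := Fin 1 × Fin q × Fin 1) (by simp) rfl
        rfl).tile.reindex rfl (by simp [mul_comm]) (by simp)
  -- The corner starts just above (2h + 1)k + h, the largest absolute value of a two-digit entry.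
  have far := (hasZeroSumArrays_tile_two_four (d := 1) (e := 0) (L := (2 * h + 1) * k + h + 1)
    (by norm_num) (by omega) 1 w q).transpose
  have top := (hcore.hcat right (disjoint_kotzigSet (by push_cast [hh]; omega))).mono
    (kotzigSet_union_subset (by omega) (by omega))
  have bottom := below.hcat far
    (disjoint_kotzigSet_signedProgression (by push_cast [hh]; omega) (by push_cast; omega))
  -- The lower strip is cut at column 2k + 1 and the upper one at 2l + 1. Relabeling the columns is
  -- harmless, since each strip has zero column sums.
  have all := top.vcat (bottom.reindex rfl rfl (β' := Fin (2 * l + 1) ⊕ Fin (4 * p))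
    (by simp; omega)) (Set.disjoint_union_right.2 ⟨disjoint_kotzigSet (by push_cast [hh]; omega),
      disjoint_kotzigSet_signedProgression (by push_cast [hh]; omega) (by push_cast; omega)⟩)
  refine (all.mono ?_).reindex rfl (by simp) (by simp)
  have hcard : (2 * k + 1 + 4 * q) * (2 * l + 1 + 4 * p) =
      2 * ((2 * h + 1) * k + h + 4 * (1 * w * q)) + 1 := by
    have h1 : 2 * l + 1 + 4 * p = 2 * (k + w) + 1 := by omega
    have h2 : h = k + w + 2 * q := by omega
    rw [h1, h2]
    ring
  rw [hcard]
  have hsmall : ∀ L U : ℤ, U ≤ h + 1 → kotzigSet h k L U ⊆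
      {v | 2 * |v| + 1 ≤ (2 * ((2 * h + 1) * k + h + 4 * (1 * w * q)) + 1 : ℕ)} := by
    rintro L U hU v ⟨x, c, h1, h2, h3, rfl⟩
    have := abs_kotzigEntry_le h1 (show |c| ≤ (h : ℤ) by omega)
    have : (0 : ℤ) ≤ w * q := by positivity
    simp only [Set.mem_ofPred_eq]
    push_cast
    linarith
  refine Set.union_subset (hsmall _ _ (by push_cast [hh]; omega))
    (Set.union_subset (hsmall _ _ (by push_cast [hh]; omega)) ?_)
  rintro v ⟨u, h1, h2, h3⟩
  simp only [Set.mem_ofPred_eq]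
  push_cast at h3
  omega

/-- Zero-sum arrays of odd dimensions. -/
lemma hasZeroSumArrays_odd {m n : ℕ} (hm : Odd m) (hn : Odd n) (hm0 : 1 < m) (hn0 : 1 < n)
    (hmn : m ≠ n) :
    HasZeroSumArrays (Fin 1) (Fin m) (Fin n) {v | 2 * |v| + 1 ≤ (m * n : ℕ)} := by
  have key : ∀ {m n : ℕ}, Odd m → Odd n → 1 < m → m < n →
      HasZeroSumArrays (Fin 1) (Fin m) (Fin n) {v | 2 * |v| + 1 ≤ (m * n : ℕ)} := by
    intro m n hm hn hm0 hmn
    have hm4 : m % 4 = 1 ∨ m % 4 = 3 := by have := Nat.odd_iff.1 hm; omega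
    have hn4 : n % 4 = 1 ∨ n % 4 = 3 := by have := Nat.odd_iff.1 hn; omega
    rcases hm4 with hm4 | hm4 <;> rcases hn4 with hn4 | hn4
    · obtain ⟨q, rfl⟩ : ∃ q, m = 2 * 2 + 1 + 4 * q := ⟨(m - 5) / 4, by omega⟩
      obtain ⟨p, rfl⟩ : ∃ p, n = 2 * 2 + 1 + 4 * p := ⟨(n - 5) / 4, by omega⟩
      exact hasZeroSumArrays_of_core p q (by omega)
        (hasZeroSumArrays_core_five_five (by push_cast; omega)) sum_kotzigEntry_two
    · obtain ⟨q, rfl⟩ : ∃ q, m = 2 * 2 + 1 + 4 * q := ⟨(m - 5) / 4, by omega⟩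
      obtain ⟨p, rfl⟩ : ∃ p, n = 2 * 1 + 1 + 4 * p := ⟨(n - 3) / 4, by omega⟩
      -- The core has three rows, so n takes the role of the number of rows.
      rw [mul_comm (2 * 2 + 1 + 4 * q)]
      exact (hasZeroSumArrays_of_core (k := 1) (l := 2) q p (by omega)
        (hasZeroSumArrays_core_three_five (by push_cast; omega)) sum_kotzigEntry_one).transpose
    · obtain ⟨q, rfl⟩ : ∃ q, m = 2 * 1 + 1 + 4 * q := ⟨(m - 3) / 4, by omega⟩
      obtain ⟨p, rfl⟩ : ∃ p, n = 2 * 2 + 1 + 4 * p := ⟨(n - 5) / 4, by omega⟩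
      exact hasZeroSumArrays_of_core p q (by omega)
        (hasZeroSumArrays_core_three_five (by push_cast; omega)) sum_kotzigEntry_one
    · obtain ⟨q, rfl⟩ : ∃ q, m = 2 * 1 + 1 + 4 * q := ⟨(m - 3) / 4, by omega⟩
      -- Both sides are 3 mod 4 and m < n, hence n ≥ 7; no 3 × 3 core is needed.
      obtain ⟨p, rfl⟩ : ∃ p, n = 2 * 3 + 1 + 4 * p := ⟨(n - 7) / 4, by omega⟩
      exact hasZeroSumArrays_of_core p q (by omega)
        (hasZeroSumArrays_core_three_seven (by push_cast; omega)) sum_kotzigEntry_one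
  rcases lt_or_gt_of_ne hmn with hlt | hlt
  · exact key hm hn hm0 hlt
  · rw [mul_comm m]
    exact (key hn hm hn0 hlt).transpose

end

/-! ### From one odd rectangle to an odd number of them -/

/-- Arrays of permutations of the integers `z` with `|z| ≤ s`, obtained from the first three
permutations of `kotzigRow`. -/
def permutationArray (s : ℤ) {κ l : Type} :
    Fin 3 ⊕ κ × Fin 2 → Fin 3 ⊕ l × Fin 2 → ℤ → ℤ
  | Sum.inl i, Sum.inl j, z => kotzigRow s (![0, 1, -1] (i + j)) z
  | Sum.inl i, Sum.inr j, z => ![1, -1] j.2 * kotzigRow s (![0, 1, -1] i) z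
  | Sum.inr i, Sum.inl j, z => ![1, -1] i.2 * kotzigRow s (![0, 1, -1] j) z
  | Sum.inr i, Sum.inr j, z => ![1, -1] i.2 * ![1, -1] j.2 * kotzigRow s 0 z

section

variable {s z z' : ℤ} {κ l : Type}

lemma kotzigRow_zero_add_one_add_neg_one (s z : ℤ) :
    kotzigRow s 0 z + kotzigRow s 1 z + kotzigRow s (-1) z = 0 := by
  simp [kotzigRow]
  split_ifs <;> ring

/-- The 3 × 3 corner is a circulant Latin square in three permutations with sum zero; the remaining
entries of a row cancel in pairs of opposite sign. -/
lemma sum_permutationArray_row [Fintype l] (i : Fin 3 ⊕ κ × Fin 2) :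
    ∑ j : Fin 3 ⊕ l × Fin 2, permutationArray s i j z = 0 := by
  have h := kotzigRow_zero_add_one_add_neg_one s z
  rw [Fintype.sum_sum_type, Fintype.sum_prod_type]
  rcases i with i | ⟨i, i'⟩
  · fin_cases i <;> simp [permutationArray, Fin.sum_univ_three] <;> linarith
  · fin_cases i' <;> simp [permutationArray, Fin.sum_univ_three] <;> linarith

lemma permutationArray_swap (i : Fin 3 ⊕ κ × Fin 2) (j : Fin 3 ⊕ l × Fin 2) :
    permutationArray s i j z = permutationArray s j i z := by
  rcases i with i | i <;> rcases j with j | j <;> simp only [permutationArray]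
  · rw [add_comm]
  · ring

/-- This form transfers the bound and the injectivity of `kotzigRow` to every cell. -/
lemma exists_permutationArray_eq (i : Fin 3 ⊕ κ × Fin 2) (j : Fin 3 ⊕ l × Fin 2) :
    ∃ x e : ℤ, |e| = 1 ∧ ∀ z, permutationArray s i j z = e * kotzigRow s x z := by
  have he : ∀ i : Fin 2, |(![1, -1] i : ℤ)| = 1 := by decide
  rcases i with i | i <;> rcases j with j | j
  · exact ⟨_, 1, abs_one, fun z => (one_mul _).symm⟩
  · exact ⟨_, _, he _, fun z => rfl⟩
  · exact ⟨_, _, he _, fun z => rfl⟩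
  · exact ⟨_, _, by rw [abs_mul, he, he, one_mul], fun z => rfl⟩

end

/-- For odd dimensions at least `3` there are arrays of permutations of the integers `z` with
`|z| ≤ s` whose rows and columns add up to zero. -/
lemma exists_zeroSum_permutations {m n s : ℕ} (hm : Odd m) (hn : Odd n) (hm0 : 1 < m)
    (hn0 : 1 < n) : ∃ Z : Fin m → Fin n → ℤ → ℤ,
      (∀ i z, ∑ j, Z i j z = 0) ∧ (∀ j z, ∑ i, Z i j z = 0) ∧
      (∀ i j z, |z| ≤ (s : ℤ) → |Z i j z| ≤ s) ∧
      ∀ i j z z', |z| ≤ (s : ℤ) → |z'| ≤ (s : ℤ) → Z i j z = Z i j z' → z = z' := by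
  have hequiv : ∀ {m : ℕ}, Odd m → 1 < m → ∃ p : ℕ, Nonempty (Fin m ≃ Fin 3 ⊕ Fin p × Fin 2) := by
    rintro m ⟨p, rfl⟩ hm
    exact ⟨p - 1, ⟨Fintype.equivOfCardEq (by simp; omega)⟩⟩
  obtain ⟨p, ⟨a⟩⟩ := hequiv hm hm0
  obtain ⟨q, ⟨b⟩⟩ := hequiv hn hn0
  refine ⟨fun i j => permutationArray s (a i) (b j), fun i z => ?_, fun j z => ?_,
    fun i j z hz => ?_, fun i j z z' hz hz' h => ?_⟩
  · rw [b.sum_comp (fun j => permutationArray s (a i) j z), sum_permutationArray_row]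
  · rw [a.sum_comp (fun i => permutationArray s i (b j) z)]
    simp only [permutationArray_swap _ (b j), sum_permutationArray_row]
  · obtain ⟨x, e, he, h⟩ := exists_permutationArray_eq (s := s) (a i) (b j)
    dsimp only
    rw [h, abs_mul, he, one_mul]
    exact abs_kotzigRow_le hz
  · obtain ⟨x, e, he, h'⟩ := exists_permutationArray_eq (s := s) (a i) (b j)
    dsimp only at h
    rw [h', h'] at h
    exact kotzigRow_injOn hz hz' (mul_left_cancel₀ (by rintro rfl; simp at he) h)

/-- Odd zero-sum arrays are lifted to families of odd size. -/
lemma HasZeroSumArrays.lift_odd {m n r : ℕ} (hm : Odd m) (hn : Odd n) (hr : Odd r) (hm0 : 1 < m)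
    (hn0 : 1 < n)
    (h : HasZeroSumArrays (Fin 1) (Fin m) (Fin n) {v | 2 * |v| + 1 ≤ (m * n : ℕ)}) :
    HasZeroSumArrays (Fin r) (Fin m) (Fin n) {v | 2 * |v| + 1 ≤ (m * n * r : ℕ)} := by
  obtain ⟨A, h1, h2, h3, h4⟩ := h
  obtain ⟨s, rfl⟩ := hr
  obtain ⟨Z, z1, z2, z3, z4⟩ := exists_zeroSum_permutations (s := s) hm hn hm0 hn0
  have ht : ∀ t : Fin (2 * s + 1), |(t : ℤ) - s| ≤ s := fun t => by
    rw [abs_le]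
    omega
  -- With r = 2s + 1, the leading part identifies the cell, and the last digit, a permutation of -s,
  -- …, s, identifies the rectangle.
  refine ⟨fun t i j => (2 * s + 1) * A 0 i j + Z i j (t - s), fun t i => ?_, fun t j => ?_,
    fun t i j => ?_, fun t i j t' i' j' h => ?_⟩
  · rw [Finset.sum_add_distrib, ← Finset.mul_sum, h1, z1]
    simp
  · rw [Finset.sum_add_distrib, ← Finset.mul_sum, h2, z2]
    simp
  · have hA := h3 0 i j
    have hZ := z3 i j _ (ht t)
    simp only [Set.mem_ofPred_eq] at hA ⊢
    have habs := abs_add_le ((2 * s + 1) * A 0 i j) (Z i j (t - s))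
    rw [abs_mul, abs_of_nonneg (by positivity : (0 : ℤ) ≤ 2 * s + 1)] at habs
    push_cast at hA ⊢
    nlinarith
  · have hZ := abs_le.1 (z3 i j _ (ht t))
    have hZ' := abs_le.1 (z3 i' j' _ (ht t'))
    have hA : A 0 i j = A 0 i' j' := by
      rcases lt_trichotomy (A 0 i j) (A 0 i' j') with hlt | heq | hlt
      · nlinarith
      · exact heq
      · nlinarith
    obtain ⟨-, rfl, rfl⟩ := h4 _ _ _ _ _ _ hA
    have := z4 _ _ _ _ (ht t) (ht t') (add_left_cancel h)
    exact ⟨Fin.ext (by omega), rfl, rfl⟩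

/-! ### Magic rectangle sets and the theorem -/

/-- Zero-sum arrays with entries `2 * x - (mnr + 1)` for `x ∈ {1, …, mnr}` give a magic rectangle
set. -/
lemma HasZeroSumArrays.exists_isMagicRectangleSet {m n r : ℕ}
    (h : HasZeroSumArrays (Fin r) (Fin m) (Fin n)
      {v | |v| < (m * n * r : ℕ) ∧ 2 ∣ v + (m * n * r + 1 : ℕ)}) :
    ∃ R : Fin r → Matrix (Fin m) (Fin n) ℕ, IsMagicRectangleSet m n r R := by
  obtain ⟨A, h1, h2, h3, h4⟩ := h
  set N := m * n * r with hN
  have hR : ∀ t i j, ∃ x : ℕ, 1 ≤ x ∧ x ≤ N ∧ 2 * (x : ℤ) = A t i j + (N + 1) := by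
    intro t i j
    obtain ⟨hlt, c, hc⟩ := h3 t i j
    rw [abs_lt] at hlt
    push_cast at hc
    exact ⟨c.toNat, by omega, by omega, by omega⟩
  choose R hR1 hRN hRA using hR
  refine ⟨R, ?_, fun t i => ?_, fun t j => ?_⟩
  · have hinj : Function.Injective (fun p : Fin r × Fin m × Fin n => R p.1 p.2.1 p.2.2) := by
      rintro ⟨t, i, j⟩ ⟨t', i', j'⟩ h
      have e1 := hRA t i j
      have e2 := hRA t' i' j'
      dsimp only at h
      rw [h] at e1
      obtain ⟨rfl, rfl, rfl⟩ := h4 _ _ _ _ _ _ (show A t i j = A t' i' j' by omega)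
      rfl
    have himage : (fun p : Fin r × Fin m × Fin n => R p.1 p.2.1 p.2.2) '' Set.univ =
        Set.Icc 1 N := by
      refine Set.eq_of_subset_of_ncard_le ?_ ?_ (Set.finite_Icc 1 N)
      · rintro _ ⟨⟨t, i, j⟩, -, rfl⟩
        exact ⟨hR1 t i j, hRN t i j⟩
      · rw [Set.ncard_image_of_injective _ hinj, Set.ncard_univ, ← Nat.card_coe_set_eq]
        simp only [Nat.card_eq_fintype_card, Fintype.card_prod, Fintype.card_fin,
          Fintype.card_Icc, Nat.card_Icc]
        exact le_of_eq (by rw [hN, Nat.add_sub_cancel]; ring)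
    rw [← himage]
    exact hinj.injOn.bijOn_image
  · zify
    rw [Finset.mul_sum]
    simp only [hRA, Finset.sum_add_distrib, h1, hN]
    simp [mul_add]
  · zify
    rw [Finset.mul_sum]
    simp only [hRA, Finset.sum_add_distrib, h2, hN]
    simp [mul_add]

/-- When N is odd, the numbers 2x - (N+1) are even, whereas the odd construction yields their
halves. -/
lemma HasZeroSumArrays.two_mul {ι α β : Type} [Fintype α] [Fintype β] {S S' : Set ℤ}
    (h : HasZeroSumArrays ι α β S) (hS : ∀ v ∈ S, 2 * v ∈ S') : HasZeroSumArrays ι α β S' := by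
  obtain ⟨A, h1, h2, h3, h4⟩ := h
  refine ⟨fun t i j => 2 * A t i j, fun t i => ?_, fun t j => ?_, fun t i j => hS _ (h3 t i j),
    fun t i j t' i' j' h => h4 _ _ _ _ _ _ (mul_left_cancel₀ two_ne_zero h)⟩
  · rw [← Finset.mul_sum, h1, mul_zero]
  · rw [← Finset.mul_sum, h2, mul_zero]

/-- Existence of magic rectangle sets. -/
lemma exists_isMagicRectangleSet {m n r : ℕ} (hm : 1 < m) (hn : 1 < n) (hmn : m ≠ n)
    (h : (Odd m ∧ Odd n ∧ Odd r) ∨ (Even m ∧ Even n ∧ (m, n) ≠ (2, 2))) :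
    ∃ R : Fin r → Matrix (Fin m) (Fin n) ℕ, IsMagicRectangleSet m n r R := by
  rcases h with ⟨h1, h2, h3⟩ | ⟨h1, h2, h3⟩
  · refine (((hasZeroSumArrays_odd h1 h2 hm hn hmn).lift_odd h1 h2 h3 hm hn).two_mul
      fun v hv => ?_).exists_isMagicRectangleSet
    obtain ⟨c, hc⟩ := (h1.mul h2).mul h3
    rw [hc] at hv ⊢
    simp only [Set.mem_ofPred_eq, abs_mul, abs_two] at hv ⊢
    exact ⟨by omega, by omega⟩
  · refine ((hasZeroSumArrays_even h1 h2 hm hn h3).mono ?_).exists_isMagicRectangleSet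
    rintro v ⟨u, -, hu, hv⟩
    obtain ⟨c, hc⟩ := (h1.mul_right n).mul_right r
    rw [hc] at hu ⊢
    simp only [Set.mem_ofPred_eq]
    push_cast at hv ⊢
    exact ⟨by omega, by rcases abs_choice v with h | h <;> omega⟩

theorem mainTheorem6 (m n r : ℕ) (hm : 1 < m) (hn : 1 < n) (hr : 1 ≤ r) (hmn : m ≠ n)
    (h : (Odd m ∧ Odd n ∧ Odd r) ∨ (Even m ∧ Even n ∧ (m, n) ≠ (2, 2))) :
    (SimpleGraph.copies r (completeBipartiteGraph (Fin m) (Fin n))).localAntimagicChromaticNumber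
        = 2 ∧
      (∃ R : Fin r → Matrix (Fin m) (Fin n) ℕ, IsMagicRectangleSet m n r R) ∧
      ∀ R : Fin r → Matrix (Fin m) (Fin n) ℕ, IsMagicRectangleSet m n r R →
        ∃ f : Sym2 (Fin r × (Fin m ⊕ Fin n)) → ℕ,
          (∀ (t : Fin r) (i : Fin m) (j : Fin n), f s((t, Sum.inl i), (t, Sum.inr j)) = R t i j) ∧
          (SimpleGraph.copies r (completeBipartiteGraph (Fin m) (Fin n))).IsLocalAntimagic f ∧
          (SimpleGraph.copies r (completeBipartiteGraph (Fin m) (Fin n))).numColors f = 2 := by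
  obtain ⟨R, hR⟩ := exists_isMagicRectangleSet (r := r) hm hn hmn h
  have hf := SimpleGraph.isLocalAntimagic_copiesLabel hm hn hr hmn hR
  refine ⟨le_antisymm ?_ ?_, ⟨R, hR⟩, fun R' hR' => ⟨SimpleGraph.copiesLabel R',
    SimpleGraph.copiesLabel_copiesEdge R',
    SimpleGraph.isLocalAntimagic_copiesLabel hm hn hr hmn hR'⟩⟩
  · exact hf.2 ▸ iInf₂_le _ hf.1
  · exact le_iInf₂ fun f hf' => hf'.two_le_numColors (u := (⟨0, hr⟩, Sum.inl ⟨0, by omega⟩))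
      (v := (⟨0, hr⟩, Sum.inr ⟨0, by omega⟩)) ⟨rfl, by simp⟩
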